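/- A graded poset is a finite partially ordered set $P$ with a unique minimum element $\hat 0$, a unique maximum element $\hat 1$, and a rank function $\rho:P\to\mathbb N$ such that $\rho(\hat 0)=0$ and $\rho(y)=\rho(x)+1$ whenever $y$ covers $x$; its rank is $\rho(\hat 1)$. For a graded poset $P$ of rank $n+1$ and $S\subseteq[1,n]=\{1,\dots,n\}$, let $f_S(P)$ be the number of chains $x_1<\cdots<x_{|S|}$ in $P$ with $\{\rho(x_1),\dots,\rho(x_{|S|})\}=S$. A poset is $r$-thick if each of its nonempty open intervals $(x,y)=\{z: x<z<y\}$ has at least $r$ elements. Theorem. Let $r\ge 1$ and $n\ge 0$ be integers, and let $a_S$ be a real number for each $S\subseteq[1,n]$. Then $$\sum_{S\subseteq[1,n]} a_S\, f_S(P)\ \ge\ 0\quad\text{for every graded poset } P \text{ of rank } n+1$$ if and only if $$\sum_{S\subseteq[1,n]} a_S\, r^{\,n-|S|} f_S(Q)\ \ge\ 0\quad\text{for every } r\text{-thick graded poset } Q \text{ of rank } n+1 .$$ -/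

import Mathlib

universe u

/-- The flag number `f_S(P)` of a ranked poset (rank function `grade ℕ`): the number of chains of
`P` whose set of ranks is exactly `S`.  As the rank function is strictly monotone, such a chain has
exactly `|S|` elements, one of each rank in `S`. -/
noncomputable def flagNumber (P : Type*) [PartialOrder P] [GradeOrder ℕ P] (S : Finset ℕ) : ℕ :=
  {C : Finset P | IsChain (· ≤ ·) (C : Set P) ∧ grade ℕ '' (C : Set P) = (S : Set ℕ)}.ncard

/-- A (finite) poset is `r`-thick if every nonempty open interval has at least `r` elements. -/
def IsThick (r : ℕ) (P : Type*) [PartialOrder P] : Prop :=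
  ∀ x y : P, (Set.Ioo x y).Nonempty → r ≤ (Set.Ioo x y).ncard

/-! Passing from thick posets to all posets: replacing each element of `P` other than `⊥` and `⊤` by
an antichain of `r` copies gives an `r`-thick poset and multiplies `f_S` by `r^|S|`, so the second
sum becomes `r^n` times the first.

Conversely, let `Q` be `r`-thick, with a fixed enumeration. A chain with rank set `S` is filled to a
maximal chain from the bottom up: at each rank outside `S`, choose one of the first `r` upper covers
of the current element that lie strictly below the next element of the chain. Thickness provides `r`
choices each time, so `r^(n-|S|) f_S(Q)` counts the maximal chains that fill their own `S`-subchain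
(`card_fills`, `pow_mul_flagNumber_eq`). An element among the first `r` stays among them when the
upper bound is lowered but remains above it (`mem_firstAtoms_of_le`). Hence, for a fixed maximal
chain, the sets `S` in question are those meeting every interval of some family
(`exists_fills_iff`). The sum of `a_S` over such `S` is nonnegative because it is a limit of
rescaled instances of the first sum, taken at the posets `IntervalPoset` (`sum_blocking_nonneg`). -/

/-- Strictly increasing families in `P` indexed by `S` whose member at `s` has rank `s`. -/
abbrev RankChain (P : Type*) [PartialOrder P] [GradeOrder ℕ P] (S : Finset ℕ) :=
  {g : S → P // (∀ s, grade ℕ (g s) = s) ∧ StrictMono g}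

theorem flagNumber_eq_card_rankChain (P : Type*) [PartialOrder P] [GradeOrder ℕ P]
    (S : Finset ℕ) : flagNumber P S = Nat.card (RankChain P S) := by
  classical
  unfold flagNumber
  rw [← Nat.card_coe_set_eq]
  symm
  refine Nat.card_eq_of_bijective
    (fun g : RankChain P S => ⟨Finset.univ.image g.1, ?_, ?_⟩) ⟨?_, ?_⟩
  · rintro _ hx _ hy -
    simp only [Finset.coe_image, Finset.coe_univ, Set.image_univ, Set.mem_range] at hx hy
    obtain ⟨s, rfl⟩ := hx
    obtain ⟨t, rfl⟩ := hy
    rcases le_total s t with h | h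
    · exact Or.inl (g.2.2.monotone h)
    · exact Or.inr (g.2.2.monotone h)
  · ext k
    simp only [Finset.coe_image, Finset.coe_univ, Set.image_univ, Set.mem_image, Set.mem_range,
      exists_exists_eq_and, g.2.1, Finset.mem_coe]
    exact ⟨fun ⟨s, hs⟩ => hs ▸ s.2, fun h => ⟨⟨k, h⟩, rfl⟩⟩
  · intro g g' h
    simp only [Subtype.mk.injEq] at h
    ext s
    have hs : g.1 s ∈ Finset.univ.image g'.1 := h ▸ Finset.mem_image_of_mem _ (Finset.mem_univ s)
    obtain ⟨t, -, ht⟩ := Finset.mem_image.1 hs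
    have := congrArg (grade ℕ) ht
    rw [g.2.1, g'.2.1] at this
    rw [← ht, Subtype.ext this]
  · rintro ⟨C, hC, hS⟩
    have key : ∀ s : S, ∃ x ∈ C, grade ℕ x = s := fun s => by
      have : (s : ℕ) ∈ grade ℕ '' (C : Set P) := hS ▸ s.2
      simpa using this
    choose g hgC hg using key
    refine ⟨⟨g, hg, fun s t hst => ?_⟩, ?_⟩
    · have hst' : grade ℕ (g s) < grade ℕ (g t) := by rw [hg, hg]; exact hst
      have hne : g s ≠ g t := fun h => hst'.ne (congrArg _ h)
      rcases hC (hgC s) (hgC t) hne with h | h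
      · exact lt_of_le_of_ne h hne
      · exact absurd (grade_mono (𝕆 := ℕ) h) (not_le.2 hst')
    · ext x
      simp only [Finset.mem_image, Finset.mem_univ, true_and]
      constructor
      · rintro ⟨s, rfl⟩
        exact hgC s
      · intro hx
        have hxS : grade ℕ x ∈ S := by
          have : grade ℕ x ∈ grade ℕ '' (C : Set P) := ⟨x, hx, rfl⟩
          rwa [hS] at this
        refine ⟨⟨_, hxS⟩, ?_⟩
        by_contra hne
        have hgr := hg ⟨_, hxS⟩
        rcases hC (hgC ⟨_, hxS⟩) hx hne with h | h
        · exact (grade_strictMono (𝕆 := ℕ) (lt_of_le_of_ne h hne)).ne hgr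
        · exact (grade_strictMono (𝕆 := ℕ) (lt_of_le_of_ne h (Ne.symm hne))).ne' hgr

/-! ### Inflation: from an arbitrary poset to an `r`-thick one. -/

/-- The poset obtained from `P` by replacing every element other than `⊥` and `⊤` by an antichain
of `r` copies. -/
@[ext] structure Inflation (r : ℕ) [NeZero r] (P : Type u) [PartialOrder P] [BoundedOrder P] :
    Type u where
  base : P
  copy : Fin r
  copy_eq : base = ⊥ ∨ base = ⊤ → copy = 0

namespace Inflation

variable {r : ℕ} [NeZero r] {P : Type u} [PartialOrder P] [BoundedOrder P]

instance : PartialOrder (Inflation r P) where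
  le p q := p = q ∨ p.base < q.base
  lt p q := p.base < q.base
  le_refl _ := Or.inl rfl
  le_trans := by
    rintro p q s (rfl | h) (rfl | h')
    exacts [Or.inl rfl, Or.inr h', Or.inr h, Or.inr (h.trans h')]
  lt_iff_le_not_ge := by
    intro p q
    constructor
    · intro h
      refine ⟨Or.inr h, ?_⟩
      rintro (rfl | h')
      exacts [lt_irrefl _ h, lt_asymm h h']
    · rintro ⟨rfl | h, h'⟩
      exacts [absurd (Or.inl rfl) h', h]
  le_antisymm := by
    rintro p q (rfl | h) (h' | h')
    exacts [rfl, rfl, h'.symm, absurd h' (lt_asymm h)]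

theorem lt_iff {p q : Inflation r P} : p < q ↔ p.base < q.base := Iff.rfl

instance : BoundedOrder (Inflation r P) where
  bot := ⟨⊥, 0, fun _ => rfl⟩
  top := ⟨⊤, 0, fun _ => rfl⟩
  bot_le p := by
    rcases eq_bot_or_bot_lt p.base with h | h
    · exact Or.inl (Inflation.ext h.symm (p.copy_eq (Or.inl h)).symm)
    · exact Or.inr h
  le_top p := by
    rcases eq_top_or_lt_top p.base with h | h
    · exact Or.inl (Inflation.ext h (p.copy_eq (Or.inr h)))
    · exact Or.inr h

theorem base_bot : (⊥ : Inflation r P).base = ⊥ := rfl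

instance [Finite P] : Finite (Inflation r P) :=
  Finite.of_injective (fun p : Inflation r P => (p.base, p.copy)) fun _ _ h =>
    Inflation.ext (congrArg Prod.fst h) (congrArg Prod.snd h)

theorem covBy_base {p q : Inflation r P} (h : p ⋖ q) : p.base ⋖ q.base := by
  refine ⟨h.1, fun w hw hw' => ?_⟩
  exact h.2 (c := ⟨w, 0, fun _ => rfl⟩) hw hw'

instance [GradeMinOrder ℕ P] : GradeMinOrder ℕ (Inflation r P) where
  grade p := grade ℕ p.base
  grade_strictMono _ _ h := grade_strictMono (lt_iff.1 h)
  covBy_grade _ _ h := (covBy_base h).grade ℕ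
  isMin_grade x h := by
    have hx : x = ⊥ := h.eq_bot
    rw [hx, base_bot]
    exact isMin_bot.grade ℕ

theorem isThick [Finite P] : IsThick r (Inflation r P) := by
  rintro x y ⟨z, hxz, hzy⟩
  have hz : ¬ (z.base = ⊥ ∨ z.base = ⊤) := by
    rintro (h | h)
    · exact not_lt_bot (h ▸ lt_iff.1 hxz)
    · exact not_top_lt (h ▸ lt_iff.1 hzy)
  let f : Fin r → Inflation r P := fun i => ⟨z.base, i, fun h => absurd h hz⟩
  have hf : Function.Injective f := fun i j hij => congrArg copy hij
  calc r = (Set.range f).ncard := by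
        rw [← Set.image_univ, Set.ncard_image_of_injective _ hf, Set.ncard_univ, Nat.card_fin]
    _ ≤ (Set.Ioo x y).ncard := by
        refine Set.ncard_le_ncard ?_ (Set.toFinite _)
        rintro _ ⟨i, rfl⟩
        exact ⟨hxz, hzy⟩

variable [GradeMinOrder ℕ P]

theorem flagNumber_eq {n : ℕ} (hn : grade ℕ (⊤ : P) = n + 1) {S : Finset ℕ}
    (hS : S ⊆ Finset.Icc 1 n) : flagNumber (Inflation r P) S = r ^ S.card * flagNumber P S := by
  -- Ranks in `S` avoid `0` and `n + 1`, so every chain member has its full `r` copies to choose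
  -- from.
  have hpos : ∀ (s : S) (x : P), grade ℕ x = s → ¬ (x = ⊥ ∨ x = ⊤) := by
    intro s x hx h
    have := Finset.mem_Icc.1 (hS s.2)
    rcases h with rfl | rfl
    · rw [grade_bot] at hx
      simp at hx
      omega
    · omega
  let e : RankChain (Inflation r P) S ≃ (S → Fin r) × RankChain P S :=
    { toFun := fun g => (fun s => (g.1 s).copy, ⟨fun s => (g.1 s).base, g.2.1, g.2.2⟩)
      invFun := fun g => ⟨fun s => ⟨g.2.1 s, g.1 s, fun h => absurd h (hpos s _ (g.2.2.1 s))⟩,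
        g.2.2.1, g.2.2.2⟩
      left_inv := fun g => rfl
      right_inv := fun g => rfl }
  rw [flagNumber_eq_card_rankChain, flagNumber_eq_card_rankChain, Nat.card_congr e, Nat.card_prod]
  simp

end Inflation

/-! ### Posets whose flag numbers detect the sets meeting every interval of a family. -/

/-- The ranked poset with levels `0, …, n + 1` in which an element of level `i` carries a label in
`Fin N` for every `j` such that `i` lies in the interval `[lo j, hi j)`.  Elements of
different levels are comparable when their common labels agree. -/
@[ext] structure IntervalPoset (n N : ℕ) [NeZero N] {J : Type u} (lo hi : J → ℕ) : Type u where
  level : Fin (n + 2)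
  label : J → Fin N
  label_eq : ∀ j, (level : ℕ) ∉ Set.Ico (lo j) (hi j) → label j = 0

namespace IntervalPoset

variable {n N : ℕ} [NeZero N] {J : Type u} {lo hi : J → ℕ}

/-- Agreement of the common labels of two elements. -/
def Agree (x y : IntervalPoset n N lo hi) : Prop :=
  ∀ j, (x.level : ℕ) ∈ Set.Ico (lo j) (hi j) → (y.level : ℕ) ∈ Set.Ico (lo j) (hi j) →
    x.label j = y.label j

/-- Intervals are convex, so a label carried by both outer elements is also carried by the middle
one. -/
theorem Agree.trans {x y z : IntervalPoset n N lo hi} (hxy : x.level < y.level)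
    (hyz : y.level < z.level) (h : Agree x y) (h' : Agree y z) : Agree x z := by
  intro j hx hz
  have hy : (y.level : ℕ) ∈ Set.Ico (lo j) (hi j) := by
    rw [Fin.lt_def] at hxy hyz
    simp only [Set.mem_Ico] at *
    omega
  exact (h j hx hy).trans (h' j hy hz)

instance : PartialOrder (IntervalPoset n N lo hi) where
  le p q := p = q ∨ p.level < q.level ∧ Agree p q
  lt p q := p.level < q.level ∧ Agree p q
  le_refl _ := Or.inl rfl
  le_trans := by
    rintro p q s (rfl | h) (rfl | h')
    exacts [Or.inl rfl, Or.inr h', Or.inr h, Or.inr ⟨h.1.trans h'.1, h.2.trans h.1 h'.1 h'.2⟩]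
  lt_iff_le_not_ge := by
    intro p q
    constructor
    · intro h
      refine ⟨Or.inr h, ?_⟩
      rintro (rfl | h')
      exacts [lt_irrefl _ h.1, lt_asymm h.1 h'.1]
    · rintro ⟨rfl | h, h'⟩
      exacts [absurd (Or.inl rfl) h', h]
  le_antisymm := by
    rintro p q (rfl | h) (h' | h')
    exacts [rfl, rfl, h'.symm, absurd h'.1 (lt_asymm h.1)]

theorem lt_iff {p q : IntervalPoset n N lo hi} : p < q ↔ p.level < q.level ∧ Agree p q := Iff.rfl

open Classical in
/-- The element of level `i` whose labels are given by `q`. -/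
noncomputable def ofLabel (lo hi : J → ℕ) (i : Fin (n + 2)) (q : J → Fin N) :
    IntervalPoset n N lo hi where
  level := i
  label j := if (i : ℕ) ∈ Set.Ico (lo j) (hi j) then q j else 0
  label_eq _ h := if_neg h

@[simp] theorem level_ofLabel (i : Fin (n + 2)) (q : J → Fin N) :
    (ofLabel lo hi i q).level = i := rfl

theorem label_ofLabel {i : Fin (n + 2)} {q : J → Fin N} {j : J}
    (h : (i : ℕ) ∈ Set.Ico (lo j) (hi j)) : (ofLabel lo hi i q).label j = q j := if_pos h

theorem agree_ofLabel (i k : Fin (n + 2)) (q : J → Fin N) :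
    Agree (ofLabel lo hi i q) (ofLabel lo hi k q) := fun _ h h' =>
  (label_ofLabel (i := i) h).trans (label_ofLabel (i := k) h').symm

theorem ext_of_agree {x y : IntervalPoset n N lo hi} (hl : x.level = y.level) (h : Agree x y) :
    x = y := by
  refine IntervalPoset.ext hl (funext fun j => ?_)
  by_cases hj : (x.level : ℕ) ∈ Set.Ico (lo j) (hi j)
  · exact h j hj (hl ▸ hj)
  · rw [x.label_eq j hj, y.label_eq j (hl ▸ hj)]

/-- Gluing the labels of `x` and `y` labels any intermediate level consistently; hence covers raise
the level by exactly one. -/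
theorem exists_between {x y : IntervalPoset n N lo hi} (h : x < y) {k : Fin (n + 2)}
    (hk : x.level < k) (hk' : k < y.level) : ∃ z, x < z ∧ z < y := by
  classical
  let q : J → Fin N := fun j =>
    if (x.level : ℕ) ∈ Set.Ico (lo j) (hi j) then x.label j else y.label j
  refine ⟨ofLabel lo hi k q, ⟨hk, fun j hx hz => ?_⟩, ⟨hk', fun j hz hy => ?_⟩⟩
  · rw [level_ofLabel] at hz
    rw [label_ofLabel hz]
    exact (if_pos hx).symm
  · rw [level_ofLabel] at hz
    rw [label_ofLabel hz]
    by_cases hx : (x.level : ℕ) ∈ Set.Ico (lo j) (hi j)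
    · exact (if_pos hx).trans (h.2 j hx hy)
    · exact if_neg hx

instance [Finite J] : Finite (IntervalPoset n N lo hi) :=
  Finite.of_injective (fun p : IntervalPoset n N lo hi => (p.level, p.label)) fun _ _ h =>
    IntervalPoset.ext (congrArg Prod.fst h) (congrArg Prod.snd h)

/-- The bounds are the unique elements of the extreme levels when all intervals lie in `[1, n]`. -/
noncomputable abbrev boundedOrder (hlo : ∀ j, 1 ≤ lo j) (hhi : ∀ j, hi j ≤ n + 1) :
    BoundedOrder (IntervalPoset n N lo hi) where
  bot := ofLabel lo hi 0 0
  top := ofLabel lo hi (Fin.last _) 0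
  bot_le p := by
    have hA : Agree (ofLabel lo hi 0 0) p := fun j h => by
      have := hlo j
      simp at h
      omega
    rcases (Fin.zero_le p.level).eq_or_lt with h | h
    · exact Or.inl (ext_of_agree h hA)
    · exact Or.inr ⟨h, hA⟩
  le_top p := by
    have hA : Agree p (ofLabel lo hi (Fin.last _) 0) := fun j _ h => by
      have := hhi j
      simp at h
      omega
    rcases (Fin.le_last p.level).eq_or_lt with h | h
    · exact Or.inl (ext_of_agree h hA)
    · exact Or.inr ⟨h, hA⟩

noncomputable instance : GradeOrder ℕ (IntervalPoset n N lo hi) where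
  grade p := p.level
  grade_strictMono _ _ h := (lt_iff.1 h).1
  covBy_grade x y h := by
    have h1 : (x.level : ℕ) < y.level := h.1.1
    rw [Nat.covBy_iff_add_one_eq]
    by_contra hne
    have := y.level.2
    obtain ⟨z, hz, hz'⟩ := exists_between h.1 (k := ⟨x.level + 1, by omega⟩)
      (by rw [Fin.lt_def]; simp) (by rw [Fin.lt_def]; simp; omega)
    exact h.2 hz hz'

theorem grade_eq (x : IntervalPoset n N lo hi) : grade ℕ x = x.level := rfl

/-- The rank function maps minimal elements to `0`. -/
noncomputable abbrev gradeMinOrder (hlo : ∀ j, 1 ≤ lo j) (hhi : ∀ j, hi j ≤ n + 1) :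
    GradeMinOrder ℕ (IntervalPoset n N lo hi) where
  isMin_grade x h := by
    let _ := boundedOrder (N := N) hlo hhi
    have hb : x = ofLabel lo hi 0 0 := h.eq_bot
    rw [hb]
    exact isMin_bot (α := ℕ)

-- A chain amounts to a free label for each interval that `S` meets. Labels of the other intervals
-- are invisible to it and are pinned to `0` to make the parametrization injective.
open Classical in
theorem flagNumber_eq [Fintype J] {S : Finset ℕ} (hS : S ⊆ Finset.Icc 1 n) :
    flagNumber (IntervalPoset n N lo hi) S =
      ∏ j, if ∃ s ∈ S, s ∈ Set.Ico (lo j) (hi j) then N else 1 := by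
  rw [flagNumber_eq_card_rankChain]
  let A : J → Finset (Fin N) := fun j =>
    if ∃ s ∈ S, s ∈ Set.Ico (lo j) (hi j) then Finset.univ else {0}
  have hA : (Fintype.piFinset A).card =
      ∏ j, if ∃ s ∈ S, s ∈ Set.Ico (lo j) (hi j) then N else 1 := by
    rw [Fintype.card_piFinset]
    refine Finset.prod_congr rfl fun j _ => ?_
    simp only [A]
    split_ifs <;> simp
  rw [← hA, ← Nat.card_eq_finsetCard]
  have hlt : ∀ s : S, (s : ℕ) < n + 2 := fun s => by
    have := Finset.mem_Icc.1 (hS s.2)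
    omega
  symm
  refine Nat.card_eq_of_bijective (fun q : Fintype.piFinset A =>
    (⟨fun s => ofLabel lo hi ⟨s, hlt s⟩ q.1, fun s => rfl,
      fun s t hst => ⟨hst, agree_ofLabel _ _ _⟩⟩ : RankChain (IntervalPoset n N lo hi) S)) ⟨?_, ?_⟩
  · intro q q' h
    ext j : 2
    by_cases hj : ∃ s ∈ S, s ∈ Set.Ico (lo j) (hi j)
    · obtain ⟨s, hs, hsj⟩ := hj
      have h1 := congrArg (fun g => (g.1 ⟨s, hs⟩).label j) h
      simp only at h1
      rwa [label_ofLabel hsj, label_ofLabel hsj] at h1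
    · have h1 := Fintype.mem_piFinset.1 q.2 j
      have h2 := Fintype.mem_piFinset.1 q'.2 j
      simp only [A, if_neg hj, Finset.mem_singleton] at h1 h2
      rw [h1, h2]
  · intro g
    let q : J → Fin N := fun j =>
      if h : ∃ s ∈ S, s ∈ Set.Ico (lo j) (hi j) then (g.1 ⟨h.choose, h.choose_spec.1⟩).label j
      else 0
    refine ⟨⟨q, Fintype.mem_piFinset.2 fun j => ?_⟩, ?_⟩
    · by_cases hj : ∃ s ∈ S, s ∈ Set.Ico (lo j) (hi j)
      · simp only [A, if_pos hj, Finset.mem_univ]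
      · simp only [A, q, if_neg hj, dif_neg hj, Finset.mem_singleton]
    -- Any two members of the chain agree, so the arbitrary rank picked in `q` does not matter.
    · have hag : ∀ s t, Agree (g.1 s) (g.1 t) := fun s t => by
        rcases lt_trichotomy s t with h | rfl | h
        · exact (g.2.2 h).2
        · exact fun j _ _ => rfl
        · exact fun j h1 h2 => ((g.2.2 h).2 j h2 h1).symm
      ext s : 2
      have hls : ((g.1 s).level : ℕ) = s := g.2.1 s
      refine ext_of_agree (Fin.ext hls.symm) fun j h1 h2 => ?_
      refine (label_ofLabel (i := ⟨s, hlt s⟩) h1).trans ?_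
      have hj : ∃ s ∈ S, s ∈ Set.Ico (lo j) (hi j) := ⟨s, s.2, h1⟩
      simp only [q, dif_pos hj]
      refine hag _ _ j ?_ h2
      have := g.2.1 ⟨hj.choose, hj.choose_spec.1⟩
      rw [grade_eq] at this
      rw [this]
      exact hj.choose_spec.2

end IntervalPoset

-- With `N + 1` labels, dividing the flag number by `(N + 1)^|J|` leaves a factor `1 / (N + 1)` for
-- each interval that `S` misses. As `N → ∞` only the sets missing no interval survive.
open Filter Topology in
open Classical in
theorem sum_blocking_nonneg (n : ℕ) (a : Finset ℕ → ℝ)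
    (h : ∀ (P : Type u) [PartialOrder P] [BoundedOrder P] [Finite P] [GradeMinOrder ℕ P],
      grade ℕ (⊤ : P) = n + 1 →
        0 ≤ ∑ S ∈ (Finset.Icc 1 n).powerset, a S * (flagNumber P S : ℝ))
    {J : Type u} [Finite J] {lo hi : J → ℕ} (hlo : ∀ j, 1 ≤ lo j) (hhi : ∀ j, hi j ≤ n + 1) :
    0 ≤ ∑ S ∈ (Finset.Icc 1 n).powerset,
      a S * if ∀ j, ∃ s ∈ S, s ∈ Set.Ico (lo j) (hi j) then 1 else 0 := by
  have := Fintype.ofFinite J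
  have hlim : Tendsto (fun N : ℕ => ∑ S ∈ (Finset.Icc 1 n).powerset,
      a S * ∏ j, if ∃ s ∈ S, s ∈ Set.Ico (lo j) (hi j) then (1 : ℝ) else 1 / ((N : ℝ) + 1)) atTop
      (𝓝 (∑ S ∈ (Finset.Icc 1 n).powerset,
        a S * ∏ j, if ∃ s ∈ S, s ∈ Set.Ico (lo j) (hi j) then (1 : ℝ) else 0)) := by
    refine tendsto_finsetSum _ fun S _ => Tendsto.const_mul _ (tendsto_finsetProd _ fun j _ => ?_)
    split_ifs
    · exact tendsto_const_nhds
    · exact tendsto_one_div_add_atTop_nhds_zero_nat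
  have hprod : ∀ S : Finset ℕ, (∏ j, if ∃ s ∈ S, s ∈ Set.Ico (lo j) (hi j) then (1 : ℝ) else 0) =
      @ite ℝ (∀ j, ∃ s ∈ S, s ∈ Set.Ico (lo j) (hi j)) (propDecidable _) 1 0 := fun S => by
    rw [Finset.prod_ite_zero, Finset.prod_const_one]
    simp only [Finset.mem_univ, true_implies]
    congr
  simp only [hprod] at hlim
  refine ge_of_tendsto' hlim fun N => ?_
  let _ := IntervalPoset.boundedOrder (N := N + 1) hlo hhi
  let _ := IntervalPoset.gradeMinOrder (N := N + 1) hlo hhi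
  have key := h (IntervalPoset n (N + 1) lo hi) rfl
  have hN : (0 : ℝ) < (N : ℝ) + 1 := by positivity
  have heq : ∀ S ∈ (Finset.Icc 1 n).powerset,
      (a S * ∏ j, if ∃ s ∈ S, s ∈ Set.Ico (lo j) (hi j) then (1 : ℝ) else 1 / ((N : ℝ) + 1)) =
        ((N : ℝ) + 1)⁻¹ ^ Fintype.card J *
          (a S * (flagNumber (IntervalPoset n (N + 1) lo hi) S : ℝ)) := fun S hS => by
    have : (flagNumber (IntervalPoset n (N + 1) lo hi) S : ℝ) =
      ∏ j, if ∃ s ∈ S, s ∈ Set.Ico (lo j) (hi j) then ((N : ℝ) + 1) else 1 := by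
      rw [IntervalPoset.flagNumber_eq (Finset.mem_powerset.1 hS)]
      push_cast
      rfl
    rw [this, mul_left_comm, ← Finset.card_univ, ← Finset.prod_const, ← Finset.prod_mul_distrib]
    congr 1
    refine Finset.prod_congr rfl fun j _ => ?_
    split_ifs
    · rw [inv_mul_cancel₀ hN.ne']
    · rw [mul_one, one_div]
  rw [Finset.sum_congr rfl heq, ← Finset.mul_sum]
  exact mul_nonneg (by positivity) key

/-! ### Counting: initial segments of an enumeration, and walks with prescribed numbers of choices.
-/

open Classical in
theorem card_filter_card_lt {α : Type*} (A : Finset α) {e : α → ℕ} (he : Function.Injective e)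
    {r : ℕ} (hr : r ≤ A.card) :
    (A.filter fun z => (A.filter fun w => e w < e z).card < r).card = r := by
  set p : α → ℕ := fun z => (A.filter fun w => e w < e z).card with hp
  have hlt : ∀ z ∈ A, ∀ w ∈ A, e z < e w → p z < p w := fun z hz w hw h => by
    refine Finset.card_lt_card ⟨fun v hv => ?_, fun hsub => ?_⟩
    · simp only [Finset.mem_filter] at hv ⊢
      exact ⟨hv.1, hv.2.trans h⟩
    · have := hsub (Finset.mem_filter.2 ⟨hz, h⟩)
      simp at this
  have hinj : Set.InjOn p A := fun z hz w hw h => by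
    rcases lt_trichotomy (e z) (e w) with h' | h' | h'
    · exact absurd h (hlt z hz w hw h').ne
    · exact he h'
    · exact absurd h (hlt w hw z hz h').ne'
  -- Being injective on `A` with values below `A.card`, `p` takes each such value exactly once.
  have himg : A.image p = Finset.range A.card := by
    refine Finset.eq_of_subset_of_card_le (fun k hk => ?_) ?_
    · obtain ⟨z, hz, rfl⟩ := Finset.mem_image.1 hk
      refine Finset.mem_range.2 (Finset.card_lt_card ⟨Finset.filter_subset _ _, fun hsub => ?_⟩)
      have := hsub hz
      simp at this
    · rw [Finset.card_image_of_injOn hinj, Finset.card_range]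
  have h2 : (A.filter fun z => p z < r).image p = Finset.range r := by
    ext k
    simp only [Finset.mem_image, Finset.mem_filter, Finset.mem_range]
    constructor
    · rintro ⟨z, hz, rfl⟩
      exact hz.2
    · intro hk
      have : k ∈ A.image p := himg ▸ Finset.mem_range.2 (hk.trans_le hr)
      obtain ⟨z, hz, rfl⟩ := Finset.mem_image.1 this
      exact ⟨z, ⟨hz, hk⟩, rfl⟩
  have h3 := congrArg Finset.card h2
  rwa [Finset.card_range, Finset.card_image_of_injOn
    (hinj.mono (Finset.coe_subset.2 (Finset.filter_subset _ _)))] at h3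

/-- The sequence `z, x 0, …, x (k - 1), t, t, …`. -/
def walk {α : Type*} (t : α) {k : ℕ} (z : α) (x : Fin k → α) : ℕ → α
  | 0 => z
  | i + 1 => if h : i < k then x ⟨i, h⟩ else t

theorem walk_succ_of_lt {α : Type*} (t : α) {k : ℕ} (z : α) (x : Fin k → α) {i : ℕ} (h : i < k) :
    walk t z x (i + 1) = x ⟨i, h⟩ := dif_pos h

theorem walk_succ_of_le {α : Type*} (t : α) {k : ℕ} (z : α) (x : Fin k → α) {i : ℕ} (h : k ≤ i) :
    walk t z x (i + 1) = t := dif_neg (not_lt.2 h)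

theorem walk_cons {α : Type*} (t : α) {k : ℕ} (z y : α) (x : Fin k → α) (i : ℕ) :
    walk t z (Fin.cons y x : Fin (k + 1) → α) (i + 1) = walk t y x i := by
  cases i with
  | zero => exact walk_succ_of_lt t z _ k.succ_pos
  | succ i =>
    by_cases h : i < k
    · rw [walk_succ_of_lt _ _ _ h, walk_succ_of_lt _ _ _ (Nat.succ_lt_succ h)]
      exact Fin.cons_succ (α := fun _ => α) y x ⟨i, h⟩
    · rw [walk_succ_of_le _ _ _ (not_lt.1 h),
        walk_succ_of_le _ _ _ (Nat.succ_le_succ (not_lt.1 h))]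

open Classical in
/-- The number of walks whose `i`-th step has exactly `w i` admissible targets is the product of
the `w i`. -/
theorem card_walks {α : Type*} [Fintype α] (t : α) (k : ℕ) (z : α) (G : ℕ → α → Finset α)
    (w : ℕ → ℕ) (I : ℕ → α → Prop) (hz : I 0 z)
    (hG : ∀ i < k, ∀ y, I i y → (G i y).card = w i ∧ ∀ y' ∈ G i y, I (i + 1) y') :
    (Finset.univ.filter fun x : Fin k → α =>
      ∀ i < k, walk t z x (i + 1) ∈ G i (walk t z x i)).card = ∏ i ∈ Finset.range k, w i := by
  -- The first step is split off and `G`, `w` and the invariant `I` are shifted by one.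
  induction k generalizing z G w I with
  | zero => simp
  | succ k ih =>
    have hcons : ∀ y (x : Fin k → α), (∀ i < k + 1, walk t z (Fin.cons y x : Fin (k + 1) → α) (i + 1)
        ∈ G i (walk t z (Fin.cons y x : Fin (k + 1) → α) i)) ↔
        y ∈ G 0 z ∧ ∀ i < k, walk t y x (i + 1) ∈ G (i + 1) (walk t y x i) := fun y x => by
      simp only [walk_cons]
      constructor
      · exact fun h => ⟨h 0 k.succ_pos, fun i hi => by
          simpa only [walk_cons] using h (i + 1) (Nat.succ_lt_succ hi)⟩
      · rintro ⟨h0, h⟩ (_ | i) hi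
        · exact h0
        · simpa only [walk_cons] using h i (Nat.lt_of_succ_lt_succ hi)
    have hsum : (Finset.univ.filter fun x : Fin (k + 1) → α =>
        ∀ i < k + 1, walk t z x (i + 1) ∈ G i (walk t z x i)).card =
        ((G 0 z).sigma fun y => Finset.univ.filter fun x : Fin k → α =>
          ∀ i < k, walk t y x (i + 1) ∈ G (i + 1) (walk t y x i)).card := by
      symm
      refine Finset.card_bij (fun p _ => (Fin.cons p.1 p.2 : Fin (k + 1) → α)) ?_ ?_ ?_
      · rintro ⟨y, x⟩ h
        simp only [Finset.mem_sigma, Finset.mem_filter, Finset.mem_univ, true_and] at h ⊢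
        exact (hcons y x).2 h
      · rintro ⟨y, x⟩ - ⟨y', x'⟩ - h
        obtain ⟨rfl, rfl⟩ := Fin.cons_inj.1 h
        rfl
      · intro x hx
        refine ⟨⟨x 0, Fin.tail x⟩, ?_, Fin.cons_self_tail x⟩
        simp only [Finset.mem_sigma, Finset.mem_filter, Finset.mem_univ, true_and] at hx ⊢
        rw [← hcons, Fin.cons_self_tail]
        exact hx
    rw [hsum, Finset.card_sigma, Finset.prod_range_succ',
      Finset.sum_congr rfl fun y hy => ih y (fun i => G (i + 1)) (fun i => w (i + 1))
        (fun i => I (i + 1)) ((hG 0 k.succ_pos z hz).2 y hy)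
        fun i hi y' hy' => hG (i + 1) (Nat.succ_lt_succ hi) y' hy',
      Finset.sum_const, (hG 0 k.succ_pos z hz).1, smul_eq_mul, mul_comm]

theorem covBy_of_grade_eq {Q : Type*} [PartialOrder Q] [GradeOrder ℕ Q] {x y : Q}
    (h : x < y) (hg : grade ℕ y = grade ℕ x + 1) : x ⋖ y :=
  (covBy_iff_lt_covBy_grade (𝕆 := ℕ)).2 ⟨h, by rw [Nat.covBy_iff_add_one_eq, hg]⟩

theorem grade_of_covBy {Q : Type*} [PartialOrder Q] [GradeOrder ℕ Q] {x y : Q}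
    (h : x ⋖ y) : grade ℕ y = grade ℕ x + 1 :=
  (Nat.covBy_iff_add_one_eq.1 (h.grade ℕ)).symm

/-! ### The first `r` upper covers below a given element. -/

section Thick

variable {Q : Type u} [PartialOrder Q] [Fintype Q]

open Classical in
/-- The upper covers of `x` lying strictly below `y`. -/
noncomputable def atomsBelow (x y : Q) : Finset Q := Finset.univ.filter fun z => x ⋖ z ∧ z < y

open Classical in
/-- The first `r` upper covers of `x` strictly below `y`, in a fixed enumeration of `Q`. -/
noncomputable def firstAtoms (r : ℕ) (x y : Q) : Finset Q :=
  (atomsBelow x y).filter fun z =>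
    ((atomsBelow x y).filter fun w => (Fintype.equivFin Q w : ℕ) < Fintype.equivFin Q z).card < r

theorem mem_atomsBelow {x y z : Q} : z ∈ atomsBelow x y ↔ x ⋖ z ∧ z < y := by
  simp [atomsBelow]

theorem atomsBelow_mono {x y y' : Q} (h : y ≤ y') : atomsBelow x y ⊆ atomsBelow x y' := fun _ hz =>
  mem_atomsBelow.2 ⟨(mem_atomsBelow.1 hz).1, (mem_atomsBelow.1 hz).2.trans_le h⟩

theorem atomsBelow_of_mem_firstAtoms {r : ℕ} {x y z : Q} (h : z ∈ firstAtoms r x y) :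
    x ⋖ z ∧ z < y := mem_atomsBelow.1 (Finset.filter_subset _ _ h)

/-- Lowering the upper bound only removes competitors that precede `z` in the enumeration. -/
theorem mem_firstAtoms_of_le {r : ℕ} {x y y' z : Q} (hz : z ∈ firstAtoms r x y') (hy : y ≤ y')
    (hzy : z < y) : z ∈ firstAtoms r x y := by
  have h := Finset.mem_filter.1 hz
  refine Finset.mem_filter.2 ⟨mem_atomsBelow.2 ⟨(mem_atomsBelow.1 h.1).1, hzy⟩, ?_⟩
  exact (Finset.card_le_card (Finset.filter_subset_filter _ (atomsBelow_mono hy))).trans_lt h.2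

variable [GradeOrder ℕ Q]

theorem card_firstAtoms {r : ℕ} (hQ : IsThick r Q) {x y : Q} (h : x < y)
    (hg : grade ℕ x + 2 ≤ grade ℕ y) : (firstAtoms r x y).card = r := by
  refine card_filter_card_lt _ (e := fun z => (Fintype.equivFin Q z : ℕ))
    (Fin.val_injective.comp (Fintype.equivFin Q).injective) ?_
  obtain ⟨z, hxz, hzy⟩ := exists_covBy_le_of_lt h
  have hz := grade_of_covBy hxz
  have hzy' : z < y := lt_of_le_of_ne hzy (by rintro rfl; omega)
  -- `v` lies two ranks above `x`, so all of the open interval from `x` to `v`, which has at least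
  -- `r` elements, consists of covers of `x` below `y`.
  obtain ⟨v, hzv, hvy⟩ := exists_covBy_le_of_lt hzy'
  have hv := grade_of_covBy hzv
  refine (hQ x v ⟨z, hxz.lt, hzv.lt⟩).trans ?_
  rw [← Set.ncard_coe_finset]
  refine Set.ncard_le_ncard (fun w hw => ?_) (Set.toFinite _)
  have h1 := grade_strictMono (𝕆 := ℕ) hw.1
  have h2 := grade_strictMono (𝕆 := ℕ) hw.2
  exact mem_atomsBelow.2 ⟨covBy_of_grade_eq hw.1 (by omega), hw.2.trans_le hvy⟩

end Thick

/-! ### The next member of a chain at or above a given rank. -/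

section NextRank

theorem exists_nextRank (n : ℕ) (S : Finset ℕ) (i : ℕ) : ∃ j, i ≤ j ∧ (j ∈ S ∨ n < j) :=
  ⟨i + n + 1, by omega, Or.inr (by omega)⟩

/-- The least `j ≥ i` such that `j ∈ S` or `n < j`. -/
def nextRank (n : ℕ) (S : Finset ℕ) (i : ℕ) : ℕ := Nat.find (exists_nextRank n S i)

variable {n : ℕ} {S : Finset ℕ} {i : ℕ}

theorem le_nextRank : i ≤ nextRank n S i := (Nat.find_spec (exists_nextRank n S i)).1

theorem nextRank_spec : nextRank n S i ∈ S ∨ n < nextRank n S i :=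
  (Nat.find_spec (exists_nextRank n S i)).2

theorem nextRank_le {j : ℕ} (h : i ≤ j) (hj : j ∈ S ∨ n < j) : nextRank n S i ≤ j :=
  Nat.find_min' _ ⟨h, hj⟩

theorem nextRank_of_mem (h : i ∈ S) : nextRank n S i = i :=
  (nextRank_le le_rfl (Or.inl h)).antisymm le_nextRank

theorem lt_nextRank (h : i ∉ S) (hi : i ≤ n) : i < nextRank n S i :=
  lt_of_le_of_ne le_nextRank fun he => by
    have := nextRank_spec (n := n) (S := S) (i := i)
    rw [← he] at this
    exact this.elim h (not_lt.2 hi)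

theorem nextRank_succ (h : i ∉ S) (hi : i ≤ n) : nextRank n S i = nextRank n S (i + 1) :=
  (nextRank_le (i.le_succ.trans le_nextRank) nextRank_spec).antisymm
    (nextRank_le (lt_nextRank h hi) nextRank_spec)

end NextRank

variable {Q : Type u} [PartialOrder Q] [BoundedOrder Q] [GradeMinOrder ℕ Q]

/-- The member of the chain `c ∪ {⊤}` of least rank at least `i`. -/
noncomputable def nextElement (n : ℕ) {S : Finset ℕ} (c : RankChain Q S) (i : ℕ) : Q :=
  if h : nextRank n S i ∈ S then c.1 ⟨nextRank n S i, h⟩ else ⊤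

section

variable {n : ℕ} {S : Finset ℕ}

theorem nextElement_of_mem (c : RankChain Q S) {i : ℕ} (h : i ∈ S) :
    nextElement n c i = c.1 ⟨i, h⟩ := by
  have h' := nextRank_of_mem (n := n) h
  simp [nextElement, h', h]

theorem nextElement_succ (c : RankChain Q S) {i : ℕ} (h : i ∉ S) (hi : i ≤ n) :
    nextElement n c i = nextElement n c (i + 1) := by
  simp [nextElement, nextRank_succ h hi]

theorem le_grade_nextElement (hn : grade ℕ (⊤ : Q) = n + 1) (c : RankChain Q S) {i : ℕ}
    (hi : i ≤ n + 1) : i ≤ grade ℕ (nextElement n c i) := by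
  by_cases h : nextRank n S i ∈ S
  · rw [nextElement, dif_pos h, c.2.1]
    exact le_nextRank
  · rw [nextElement, dif_neg h, hn]
    exact hi

theorem lt_nextElement_succ (hn : grade ℕ (⊤ : Q) = n + 1) (hS : S ⊆ Finset.Icc 1 n)
    (c : RankChain Q S) {i : ℕ} (h : i ∈ S) : c.1 ⟨i, h⟩ < nextElement n c (i + 1) := by
  by_cases h' : nextRank n S (i + 1) ∈ S
  · rw [nextElement, dif_pos h']
    exact c.2.2 (Subtype.mk_lt_mk.2 le_nextRank)
  · rw [nextElement, dif_neg h', lt_top_iff_ne_top]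
    intro htop
    have h1 := c.2.1 ⟨i, h⟩
    have h2 := Finset.mem_Icc.1 (hS h)
    rw [htop, hn] at h1
    simp only at h1
    omega

theorem bot_lt_nextElement_one (hn : grade ℕ (⊤ : Q) = n + 1) (c : RankChain Q S) :
    grade ℕ (⊥ : Q) = 0 ∧ (⊥ : Q) < nextElement n c 1 := by
  have h0 : grade ℕ (⊥ : Q) = 0 := grade_bot
  refine ⟨h0, bot_lt_iff_ne_bot.2 fun h => ?_⟩
  have := le_grade_nextElement hn c (i := 1) (by omega)
  rw [h] at this
  omega

theorem nextElement_eq_walk {c : RankChain Q S}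
    {x : Fin n → Q} (h : ∀ s : S, c.1 s = walk ⊤ ⊥ x s) {i : ℕ} (hi : i ≤ n + 1) :
    nextElement n c i = walk ⊤ ⊥ x (nextRank n S i) := by
  by_cases h' : nextRank n S i ∈ S
  · rw [nextElement, dif_pos h', h]
  · have h1 : nextRank n S i = n + 1 :=
      (nextRank_le hi (Or.inr n.lt_succ_self)).antisymm (nextRank_spec.resolve_left h')
    rw [nextElement, dif_neg h', h1, walk_succ_of_le _ _ _ le_rfl]

end

/-! ### Filling chains to maximal chains, and double counting. -/

variable [Fintype Q]

open Classical in
/-- The admissible elements of rank `i + 1` following `y` in a filling of the chain `c`. -/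
noncomputable def fillStep (r n : ℕ) {S : Finset ℕ} (c : RankChain Q S) (i : ℕ) (y : Q) :
    Finset Q :=
  if i + 1 ∈ S then {nextElement n c (i + 1)} else firstAtoms r y (nextElement n c (i + 1))

/-- The maximal chain `⊥, x 0, …, x (n - 1), ⊤` extends `c`, and each of its members whose rank is
not in `S` is among the first `r` possible choices given its predecessor. -/
def Fills (r : ℕ) {n : ℕ} {S : Finset ℕ} (x : Fin n → Q) (c : RankChain Q S) : Prop :=
  ∀ i < n, walk ⊤ ⊥ x (i + 1) ∈ fillStep r n c i (walk ⊤ ⊥ x i)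

variable {r n : ℕ} {S : Finset ℕ}

/-- This propagates the invariant of a filling: the current element has the expected rank and lies
strictly below the next chain member, so it can be continued. -/
theorem fillStep_spec (hn : grade ℕ (⊤ : Q) = n + 1) (hS : S ⊆ Finset.Icc 1 n) (c : RankChain Q S)
    {i : ℕ} (hi : i < n) {y y' : Q} (hy : grade ℕ y = i ∧ y < nextElement n c (i + 1))
    (hy' : y' ∈ fillStep r n c i y) :
    y < y' ∧ grade ℕ y' = i + 1 ∧ y' < nextElement n c (i + 1 + 1) := by
  unfold fillStep at hy'
  split_ifs at hy' with h
  · rw [Finset.mem_singleton] at hy'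
    subst hy'
    refine ⟨hy.2, ?_⟩
    rw [nextElement_of_mem c h]
    exact ⟨c.2.1 _, lt_nextElement_succ hn hS c h⟩
  · obtain ⟨h1, h2⟩ := atomsBelow_of_mem_firstAtoms hy'
    refine ⟨h1.lt, by rw [grade_of_covBy h1, hy.1], ?_⟩
    rwa [← nextElement_succ c h hi]

open Classical in
theorem card_fills (hn : grade ℕ (⊤ : Q) = n + 1) (hS : S ⊆ Finset.Icc 1 n) (hQ : IsThick r Q)
    (c : RankChain Q S) :
    (Finset.univ.filter fun x : Fin n → Q => Fills r x c).card = r ^ (n - S.card) := by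
  refine Eq.trans ?_ ((card_walks ⊤ n ⊥ (fillStep r n c) (fun i => if i + 1 ∈ S then 1 else r)
    (fun i y => grade ℕ y = i ∧ y < nextElement n c (i + 1)) (bot_lt_nextElement_one hn c)
    ?_).trans ?_)
  · unfold Fills
    congr
  · intro i hi y hy
    refine ⟨?_, fun y' hy' => (fillStep_spec hn hS c hi hy hy').2⟩
    unfold fillStep
    split_ifs with h
    · exact Finset.card_singleton _
    · refine card_firstAtoms hQ hy.2 ?_
      -- Since `i + 1 ∉ S`, the next chain member has rank at least `i + 2`, as `card_firstAtoms`
      -- requires.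
      rw [hy.1, nextElement_succ c h hi]
      exact le_grade_nextElement hn c (by omega)
  · rw [Finset.prod_ite, Finset.prod_const_one, one_mul, Finset.prod_const]
    congr 1
    have h1 : ((Finset.range n).filter fun i => i + 1 ∈ S).card = S.card := by
      refine Finset.card_bij (fun i _ => i + 1) (fun i hi => (Finset.mem_filter.1 hi).2)
        (fun _ _ _ _ h => Nat.succ_injective h) fun s hs => ?_
      have := Finset.mem_Icc.1 (hS hs)
      have hs1 : s - 1 + 1 = s := by omega
      exact ⟨s - 1, Finset.mem_filter.2 ⟨Finset.mem_range.2 (by omega), hs1 ▸ hs⟩, hs1⟩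
    have h2 := Finset.card_filter_add_card_filter_not (s := Finset.range n) (fun i => i + 1 ∈ S)
    rw [h1, Finset.card_range] at h2
    omega

theorem Fills.rank (hn : grade ℕ (⊤ : Q) = n + 1) (hS : S ⊆ Finset.Icc 1 n) {c : RankChain Q S}
    {x : Fin n → Q} (h : Fills r x c) : ∀ i ≤ n, grade ℕ (walk ⊤ ⊥ x i) = i ∧
      walk ⊤ ⊥ x i < nextElement n c (i + 1) := by
  intro i
  induction i with
  | zero => exact fun _ => bot_lt_nextElement_one hn c
  | succ i ih => exact fun hi => (fillStep_spec hn hS c hi (ih (by omega)) (h i hi)).2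

theorem Fills.walk_lt (hn : grade ℕ (⊤ : Q) = n + 1) (hS : S ⊆ Finset.Icc 1 n) {c : RankChain Q S}
    {x : Fin n → Q} (h : Fills r x c) : ∀ i ≤ n, grade ℕ (walk ⊤ ⊥ x i) = i ∧
      walk ⊤ ⊥ x i < walk ⊤ ⊥ x (i + 1) := by
  intro i hi
  have hr := h.rank hn hS i hi
  refine ⟨hr.1, ?_⟩
  rcases hi.eq_or_lt with rfl | hi
  · rw [walk_succ_of_le _ _ _ le_rfl]
    exact hr.2.trans_le le_top
  · exact (fillStep_spec hn hS c hi hr (h i hi)).1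

theorem Fills.eq_walk (hS : S ⊆ Finset.Icc 1 n) {c : RankChain Q S}
    {x : Fin n → Q} (h : Fills r x c) (s : S) : c.1 s = walk ⊤ ⊥ x s := by
  have hs := Finset.mem_Icc.1 (hS s.2)
  have hs1 : (s : ℕ) - 1 + 1 = s := by omega
  have := h (s - 1) (by omega)
  rw [hs1] at this
  rw [fillStep, if_pos (hs1.symm ▸ s.2), Finset.mem_singleton, hs1, nextElement_of_mem c s.2] at this
  exact this.symm

theorem Fills.unique (hS : S ⊆ Finset.Icc 1 n) {c c' : RankChain Q S}
    {x : Fin n → Q} (h : Fills r x c) (h' : Fills r x c') : c = c' :=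
  Subtype.ext (funext fun s => (h.eq_walk hS s).trans (h'.eq_walk hS s).symm)

/-- For a fixed maximal chain, the rank sets `S` for which it fills its own `S`-subchain are those
meeting every interval from a fixed family. -/
theorem exists_fills_iff (hS : S ⊆ Finset.Icc 1 n) {x : Fin n → Q}
    (hx : ∀ i ≤ n, grade ℕ (walk ⊤ ⊥ x i) = i ∧ walk ⊤ ⊥ x i < walk ⊤ ⊥ x (i + 1)) :
    (∃ c : RankChain Q S, Fills r x c) ↔ ∀ i j, i + 1 < j → j ≤ n + 1 →
      walk ⊤ ⊥ x (i + 1) ∉ firstAtoms r (walk ⊤ ⊥ x i) (walk ⊤ ⊥ x j) →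
        ∃ s ∈ S, s ∈ Set.Ico (i + 1) j := by
  have hlt : ∀ i j, i < j → j ≤ n + 1 → walk ⊤ ⊥ x i < walk ⊤ ⊥ x j := fun i j hij hj => by
    induction j, hij using Nat.le_induction with
    | base => exact (hx i (by omega)).2
    | succ j hij ih => exact (ih (by omega)).trans (hx j (by omega)).2
  have hnext : ∀ i ≤ n, nextRank n S (i + 1) ≤ n + 1 := fun i hi =>
    nextRank_le (by omega) (Or.inr n.lt_succ_self)
  constructor
  · rintro ⟨c, hc⟩ i j hij hj hbad
    by_contra! hno
    have hiS : i + 1 ∉ S := fun h => hno _ h ⟨le_rfl, hij⟩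
    have hle : j ≤ nextRank n S (i + 1) := by
      rcases nextRank_spec (n := n) (S := S) (i := i + 1) with h | h
      · by_contra! h'
        exact hno _ h ⟨le_nextRank, h'⟩
      · omega
    have hmem := hc i (by omega)
    rw [fillStep, if_neg hiS, nextElement_eq_walk (hc.eq_walk hS) (by omega)] at hmem
    -- `S` misses `[i + 1, j)`, so the next chain member lies at rank `j` or higher; the choice made
    -- below it is also valid below the element of rank `j`.
    refine hbad (mem_firstAtoms_of_le hmem ?_ (hlt _ _ hij hj))
    rcases hle.eq_or_lt with h | h
    · rw [← h]
    · exact (hlt _ _ h (hnext i (by omega))).le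
  · intro h
    have hSn : ∀ s : S, (s : ℕ) ≤ n := fun s => (Finset.mem_Icc.1 (hS s.2)).2
    refine ⟨⟨fun s => walk ⊤ ⊥ x s, fun s => (hx s (hSn s)).1,
      fun s t hst => hlt s t hst ((hSn t).trans n.le_succ)⟩, fun i hi => ?_⟩
    by_cases hiS : i + 1 ∈ S
    · rw [fillStep, if_pos hiS, nextElement_of_mem _ hiS, Finset.mem_singleton]
    · rw [fillStep, if_neg hiS, nextElement_eq_walk (fun _ => rfl) (by omega)]
      by_contra hbad
      -- The interval ending at the next rank of `S` (or at `n + 1`) contains no element of `S`,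
      -- against the hypothesis.
      obtain ⟨s, hs, hs'⟩ := h i _ (lt_nextRank hiS hi) (hnext i hi.le) hbad
      exact absurd (nextRank_le hs'.1 (Or.inl hs)) (not_le.2 hs'.2)

-- Pairs of a chain and a filling are counted in two ways; a maximal chain fills at most one chain
-- with rank set `S`.
open Classical in
theorem pow_mul_flagNumber_eq (hn : grade ℕ (⊤ : Q) = n + 1) (hS : S ⊆ Finset.Icc 1 n)
    (hQ : IsThick r Q) : r ^ (n - S.card) * flagNumber Q S =
      ∑ x : Fin n → Q, if ∃ c : RankChain Q S, Fills r x c then 1 else 0 := by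
  have := Fintype.ofFinite (RankChain Q S)
  have h := Finset.sum_card_bipartiteAbove_eq_sum_card_bipartiteBelow
    (s := (Finset.univ : Finset (Fin n → Q))) (t := (Finset.univ : Finset (RankChain Q S)))
    (Fills r)
  simp only [Finset.bipartiteBelow, card_fills hn hS hQ, Finset.sum_const, Finset.card_univ,
    smul_eq_mul] at h
  rw [flagNumber_eq_card_rankChain, Nat.card_eq_fintype_card, mul_comm, ← h]
  refine Finset.sum_congr rfl fun x _ => ?_
  split_ifs with hc
  · obtain ⟨c, hc⟩ := hc
    refine Finset.card_eq_one.2 ⟨c, Finset.eq_singleton_iff_unique_mem.2 ⟨?_, fun c' hc' => ?_⟩⟩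
    · simpa [Finset.bipartiteAbove] using hc
    · simp only [Finset.bipartiteAbove, Finset.mem_filter] at hc'
      exact hc'.2.unique hS hc
  · refine Finset.card_eq_zero.2 (Finset.filter_eq_empty_iff.2 fun c _ h => hc ⟨c, h⟩)

open Classical in
theorem sum_exists_fills_nonneg (a : Finset ℕ → ℝ) (hn : grade ℕ (⊤ : Q) = n + 1)
    (h : ∀ (P : Type u) [PartialOrder P] [BoundedOrder P] [Finite P] [GradeMinOrder ℕ P],
      grade ℕ (⊤ : P) = n + 1 →
        0 ≤ ∑ S ∈ (Finset.Icc 1 n).powerset, a S * (flagNumber P S : ℝ)) (x : Fin n → Q) :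
    0 ≤ ∑ S ∈ (Finset.Icc 1 n).powerset,
      a S * if ∃ c : RankChain Q S, Fills r x c then 1 else 0 := by
  by_cases hx : ∀ i ≤ n, grade ℕ (walk ⊤ ⊥ x i) = i ∧ walk ⊤ ⊥ x i < walk ⊤ ⊥ x (i + 1)
  -- The bad pairs `(i, j)` index the intervals `[i + 1, j)` that `S` must meet; `ULift` keeps the
  -- resulting poset in `Type u`.
  · let J := ULift.{u} {p : Fin (n + 2) × Fin (n + 2) // (p.1 : ℕ) + 1 < p.2 ∧
      walk ⊤ ⊥ x (p.1 + 1) ∉ firstAtoms r (walk ⊤ ⊥ x p.1) (walk ⊤ ⊥ x p.2)}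
    have key := sum_blocking_nonneg n a h (J := J) (lo := fun p => p.down.1.1 + 1)
      (hi := fun p => p.down.1.2) (fun p => by omega) (fun p => by omega)
    refine key.trans_eq (Finset.sum_congr rfl fun S hS => ?_)
    have hiff : (∀ p : J, ∃ s ∈ S, s ∈ Set.Ico (p.down.1.1 + 1 : ℕ) p.down.1.2) ↔
        ∃ c : RankChain Q S, Fills r x c := by
      rw [exists_fills_iff (Finset.mem_powerset.1 hS) hx]
      constructor
      · intro hJ i j hij hj hbad
        exact hJ ⟨⟨(⟨i, by omega⟩, ⟨j, by omega⟩), hij, hbad⟩⟩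
      · intro hbl p
        exact hbl _ _ p.down.2.1 (by omega) p.down.2.2
    by_cases hc : ∃ c : RankChain Q S, Fills r x c
    · rw [if_pos hc, if_pos (hiff.2 hc)]
    · rw [if_neg hc, if_neg (mt hiff.1 hc)]
  -- A tuple that is not a maximal chain with the right ranks fills no chain, so every term
  -- vanishes.
  · refine (Finset.sum_eq_zero fun S hS => ?_).ge
    rw [if_neg, mul_zero]
    rintro ⟨c, hc⟩
    exact hx (hc.walk_lt hn (Finset.mem_powerset.1 hS))

/-! ### The equivalence. -/

/-- A graded poset of rank `n + 1` is a finite poset with least and greatest elements and with a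
rank function to `ℕ` that maps the least element to `0`, respects covering, and takes the value
`n + 1` at the greatest element. -/
theorem theorem3p1 (r : ℕ) (hr : 0 < r) (n : ℕ) (a : Finset ℕ → ℝ) :
    (∀ (P : Type u) [PartialOrder P] [BoundedOrder P] [Finite P] [GradeMinOrder ℕ P],
        grade ℕ (⊤ : P) = n + 1 →
          0 ≤ ∑ S ∈ (Finset.Icc 1 n).powerset, a S * (flagNumber P S : ℝ)) ↔
      (∀ (Q : Type u) [PartialOrder Q] [BoundedOrder Q] [Finite Q] [GradeMinOrder ℕ Q],
        grade ℕ (⊤ : Q) = n + 1 → IsThick r Q →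
          0 ≤ ∑ S ∈ (Finset.Icc 1 n).powerset,
            a S * (r : ℝ) ^ (n - S.card) * (flagNumber Q S : ℝ)) := by
  constructor
  · intro h Q _ _ _ _ hn hQ
    classical
    have := Fintype.ofFinite Q
    have hsum : ∀ S ∈ (Finset.Icc 1 n).powerset,
        a S * (r : ℝ) ^ (n - S.card) * (flagNumber Q S : ℝ) =
          ∑ x : Fin n → Q, a S * if ∃ c : RankChain Q S, Fills r x c then 1 else 0 := fun S hS => by
      have := congrArg (Nat.cast : ℕ → ℝ) (pow_mul_flagNumber_eq hn (Finset.mem_powerset.1 hS) hQ)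
      push_cast at this
      rw [mul_assoc, this, Finset.mul_sum]
    rw [Finset.sum_congr rfl hsum, Finset.sum_comm]
    exact Finset.sum_nonneg fun x _ => sum_exists_fills_nonneg a hn h x
  · intro h P _ _ _ _ hn
    have : NeZero r := ⟨hr.ne'⟩
    have key := h (Inflation r P) hn Inflation.isThick
    have hsum : ∀ S ∈ (Finset.Icc 1 n).powerset,
        a S * (r : ℝ) ^ (n - S.card) * (flagNumber (Inflation r P) S : ℝ) =
          (r : ℝ) ^ n * (a S * (flagNumber P S : ℝ)) := fun S hS => by
      have hS := Finset.mem_powerset.1 hS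
      have hc : S.card ≤ n := by simpa using Finset.card_le_card hS
      rw [Inflation.flagNumber_eq hn hS]
      push_cast
      rw [← pow_sub_mul_pow (r : ℝ) hc]
      ring
    rw [Finset.sum_congr rfl hsum, ← Finset.mul_sum] at key
    exact nonneg_of_mul_nonneg_right key (by positivity)
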